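/- Let $K$ be a field of characteristic zero and let $\mathcal A$ be a unital associative $K$-algebra (not necessarily commutative), with identity element $1_{\mathcal A}$. Let $\delta:\mathcal A\to\mathcal A$ be a $K$-linear map which is either a $K$-derivation, i.e. $\delta(ab)=\delta(a)b+a\delta(b)$ for all $a,b\in\mathcal A$, or a $K$-$\mathcal E$-derivation, i.e. $\delta(ab)=\delta(a)b+a\delta(b)-\delta(a)\delta(b)$ for all $a,b\in\mathcal A$. Assume that $\delta$ is locally finite, i.e. for each $a\in\mathcal A$ the $K$-subspace of $\mathcal A$ spanned by $\delta^i(a)$ $(i\ge 0)$ is finite dimensional over $K$. Then $1_{\mathcal A}\in\operatorname{im}\delta:=\delta(\mathcal A)$ if and only if $\delta$ is surjective. -/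

import Mathlib

/-- A `K`-linear endomorphism `η` of a `K`-module `V` is locally finite if, for each `a`, the
`K`-subspace spanned by the elements `η^i(a)` (`i ≥ 0`) is finite dimensional over `K`. -/
def IsLocallyFiniteEnd {K V : Type*} [Field K] [AddCommGroup V] [Module K V]
    (η : V →ₗ[K] V) : Prop :=
  ∀ a : V, FiniteDimensional K (Submodule.span K (Set.range fun i : ℕ => (η ^ i) a))

/-- A `K`-derivation of a (not necessarily commutative) `K`-algebra `A`: a `K`-linear map
`D : A → A` with `D(ab) = D(a)b + aD(b)`. Mathlib's `Derivation` covers only commutative `A`. -/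
def IsKDerivation {K A : Type*} [Field K] [Ring A] [Algebra K A] (D : A →ₗ[K] A) : Prop :=
  ∀ a b : A, D (a * b) = D a * b + a * D b

/-- A `K`-`ℰ`-derivation of a (not necessarily commutative) `K`-algebra `A`: a `K`-linear map
`δ : A → A` with `δ(ab) = δ(a)b + aδ(b) - δ(a)δ(b)`. -/
def IsKEDerivation {K A : Type*} [Field K] [Ring A] [Algebra K A] (δ : A →ₗ[K] A) : Prop :=
  ∀ a b : A, δ (a * b) = δ a * b + a * δ b - δ a * δ b

/-! By Fitting's lemma on finite-dimensional invariant subspaces, only the generalized kernel `N` of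
`δ` has to be shown to lie in the image. Let `δ u = 1`, and let `g` satisfy `δ g = 0` and `g * a =
a` on `N`. Rising factorials of `u` times `g`, divided by `k!`, are iterated antiderivatives `Q k`
of `Q 0 = g`; integrating by parts, by induction on nilpotency, puts each `Q k * a`, hence `a = g *
a`, in the image. For a derivation `g = 1`. For an `ℰ`-derivation `1 - δ` is multiplicative but may
move `1`, and `g` is the stable value of `(1 - δ) ^ m` at `1`. -/

theorem exists_eq_add_pow_apply_of_map_mem {K V : Type*} [Field K] [AddCommGroup V] [Module K V]
    (η : V →ₗ[K] V) (W : Submodule K V) [FiniteDimensional K W] (hW : ∀ x ∈ W, η x ∈ W)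
    {a : V} (ha : a ∈ W) :
    ∃ (n : ℕ) (b c : V), (η ^ (n + 1)) b = 0 ∧ a = b + (η ^ (n + 1)) c := by
  obtain ⟨n, hn⟩ := Filter.eventually_atTop.1
    (LinearMap.eventually_codisjoint_ker_pow_range_pow (η.restrict hW))
  have h : (⟨a, ha⟩ : W) ∈
      LinearMap.ker (η.restrict hW ^ (n + 1)) ⊔ LinearMap.range (η.restrict hW ^ (n + 1)) := by
    rw [codisjoint_iff.1 (hn (n + 1) (Nat.le_succ n))]
    trivial
  obtain ⟨b, hb, _, ⟨c, rfl⟩, hbc⟩ := Submodule.mem_sup.1 h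
  have key : ∀ x : W, ((η.restrict hW ^ (n + 1)) x : V) = (η ^ (n + 1)) x := by
    intro x
    rw [Module.End.pow_restrict (n + 1) hW]
    rfl
  refine ⟨n, b, c, ?_, ?_⟩
  · rw [← key, LinearMap.mem_ker.1 hb]
    rfl
  · rw [← key, ← Submodule.coe_add, hbc]

theorem map_mem_span_range_pow {K V : Type*} [Field K] [AddCommGroup V] [Module K V]
    (η : V →ₗ[K] V) (a : V) {x : V}
    (hx : x ∈ Submodule.span K (Set.range fun i : ℕ => (η ^ i) a)) :
    η x ∈ Submodule.span K (Set.range fun i : ℕ => (η ^ i) a) := by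
  refine (Submodule.span_le (p := (Submodule.span K
    (Set.range fun i : ℕ => (η ^ i) a)).comap η)).2 ?_ hx
  rintro _ ⟨i, rfl⟩
  refine Submodule.subset_span ⟨i + 1, ?_⟩
  simp only [pow_succ', Module.End.mul_apply]

theorem self_mem_span_range_pow {K V : Type*} [Field K] [AddCommGroup V] [Module K V]
    (η : V →ₗ[K] V) (a : V) : a ∈ Submodule.span K (Set.range fun i : ℕ => (η ^ i) a) :=
  Submodule.subset_span ⟨0, by simp⟩

/-- For a locally finite endomorphism, surjectivity only has to be checked on the generalized
kernel. -/
theorem IsLocallyFiniteEnd.surjective_of_ker_pow_le_range {K V : Type*} [Field K]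
    [AddCommGroup V] [Module K V] {η : V →ₗ[K] V} (hη : IsLocallyFiniteEnd η)
    (h : ∀ (n : ℕ) (a : V), (η ^ n) a = 0 → a ∈ LinearMap.range η) :
    Function.Surjective η := by
  intro a
  have := hη a
  obtain ⟨n, b, c, hb, rfl⟩ := exists_eq_add_pow_apply_of_map_mem η _
    (fun _ hx => map_mem_span_range_pow η a hx) (self_mem_span_range_pow η a)
  -- The exponent `n + 1` is positive, so the second Fitting component is in the range.
  refine LinearMap.mem_range.1 (add_mem (h _ b hb) ⟨(η ^ n) c, ?_⟩)
  rw [pow_succ', Module.End.mul_apply]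

/-- A sequence of iterated `δ`-antiderivatives `Q k` allows one to solve `δ x = Q k * a` on the
generalized kernel of `δ`. The parameter `ε` is `0` for derivations, `1` for `ℰ`-derivations. -/
theorem mul_mem_range_of_pow_apply_eq_zero {K A : Type*} [Field K] [Ring A] [Algebra K A]
    {δ : A →ₗ[K] A} (ε : K) (Q : ℕ → A)
    (hQ : ∀ k a, δ (Q (k + 1) * a) = Q k * a + Q (k + 1) * δ a - ε • (Q k * δ a)) (n : ℕ) :
    ∀ (a : A), (δ ^ n) a = 0 → ∀ k, Q k * a ∈ LinearMap.range δ := by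
  induction n with
  | zero =>
    intro a ha k
    have ha : a = 0 := by simpa using ha
    simp [ha]
  | succ n ih =>
    intro a ha k
    have hδa : (δ ^ n) (δ a) = 0 := by rwa [pow_succ, Module.End.mul_apply] at ha
    have h : Q k * a = δ (Q (k + 1) * a) - Q (k + 1) * δ a + ε • (Q k * δ a) := by
      rw [hQ]
      abel
    rw [h]
    exact add_mem (sub_mem ⟨_, rfl⟩ (ih _ hδa _)) (Submodule.smul_mem _ _ (ih _ hδa _))

/-- The sequence `u (u + ε) ⋯ (u + (k - 1) ε) g / k!`. -/
noncomputable def risingSeq {K A : Type*} [Field K] [Ring A] [Algebra K A] (ε : K) (u g : A) :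
    ℕ → A
  | 0 => g
  | k + 1 => ((k : K) + 1)⁻¹ • (u * risingSeq ε u g k + (ε * k) • risingSeq ε u g k)

theorem smul_risingSeq_succ {K A : Type*} [Field K] [CharZero K] [Ring A] [Algebra K A]
    (ε : K) (u g : A) (k : ℕ) :
    ((k : K) + 1) • risingSeq ε u g (k + 1) =
      u * risingSeq ε u g k + (ε * k) • risingSeq ε u g k := by
  rw [risingSeq, smul_inv_smul₀ (Nat.cast_add_one_ne_zero k)]

/-- If `δ` obeys the twisted Leibniz rule with parameter `ε`, and `δ u = 1`, `δ g = 0`, then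
`risingSeq ε u g` is a sequence of iterated `δ`-antiderivatives. -/
theorem apply_risingSeq_succ {K A : Type*} [Field K] [CharZero K] [Ring A] [Algebra K A]
    {δ : A →ₗ[K] A} {ε : K} (hδ : ∀ a b, δ (a * b) = δ a * b + a * δ b - ε • (δ a * δ b))
    {u g : A} (hu : δ u = 1) (hg : δ g = 0) (k : ℕ) :
    δ (risingSeq ε u g (k + 1)) = risingSeq ε u g k := by
  induction k with
  | zero => simp [risingSeq, hδ, hu, hg]
  | succ k ih =>
    have h0 : ((k : K) + 1 + 1) ≠ 0 := by exact_mod_cast Nat.cast_add_one_ne_zero (R := K) (k + 1)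
    have hk := smul_risingSeq_succ ε u g k
    have hk1 := congrArg δ (smul_risingSeq_succ ε u g (k + 1))
    push_cast at hk1
    -- The twist contributes `-ε` times term `k + 1 - 1 = k`, turning the coefficient `ε * (k + 1)`
    -- into `ε * k`, so the recursion at `k` applies.
    rw [map_smul, map_add, map_smul, hδ, hu, ih, one_mul, one_mul] at hk1
    refine smul_right_injective A h0 ?_
    simp only
    rw [hk1, add_smul ((k : K) + 1), one_smul, hk]
    module

theorem IsLocallyFiniteEnd.surjective_of_twisted_leibniz {K A : Type*} [Field K] [CharZero K]
    [Ring A] [Algebra K A] {δ : A →ₗ[K] A} (hLF : IsLocallyFiniteEnd δ) {ε : K}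
    (hδ : ∀ a b, δ (a * b) = δ a * b + a * δ b - ε • (δ a * δ b))
    {u g : A} (hu : δ u = 1) (hg : δ g = 0)
    (hgN : ∀ (n : ℕ) (a : A), (δ ^ n) a = 0 → g * a = a) : Function.Surjective δ := by
  refine hLF.surjective_of_ker_pow_le_range fun n a ha => ?_
  have h := mul_mem_range_of_pow_apply_eq_zero (δ := δ) ε (risingSeq ε u g)
    (fun k a => by rw [hδ, apply_risingSeq_succ hδ hu hg]) n a ha 0
  rwa [risingSeq, hgN n a ha] at h

/-- The polynomials `X ^ n` and `(1 - X) ^ m` are coprime. -/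
theorem eq_zero_of_pow_apply_eq_zero {K V : Type*} [Field K] [AddCommGroup V] [Module K V]
    {η : V →ₗ[K] V} (m n : ℕ) :
    ∀ x : V, (η ^ n) x = 0 → ((1 - η) ^ m) x = 0 → x = 0 := by
  induction n with
  | zero => intro x hx _; simpa using hx
  | succ n ih =>
    intro x hx hm
    have hc : Commute ((1 - η) ^ m) η :=
      ((Commute.one_left η).sub_left (Commute.refl η)).pow_left m
    have hηx : η x = 0 := by
      refine ih (η x) ?_ ?_
      · rwa [pow_succ, Module.End.mul_apply] at hx
      · rw [← Module.End.mul_apply, hc.eq, Module.End.mul_apply, hm, map_zero]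
    have hfix : ∀ j : ℕ, ((1 - η) ^ j) x = x := by
      intro j
      induction j with
      | zero => simp
      | succ j ihj =>
        rw [pow_succ', Module.End.mul_apply, ihj, LinearMap.sub_apply, hηx, sub_zero,
          Module.End.one_apply]
    rw [← hfix m, hm]

theorem pow_apply_mul_of_apply_mul {K A : Type*} [Field K] [Ring A] [Algebra K A]
    {φ : A →ₗ[K] A} (hφ : ∀ a b, φ (a * b) = φ a * φ b) (n : ℕ) (a b : A) :
    (φ ^ n) (a * b) = (φ ^ n) a * (φ ^ n) b := by
  induction n with
  | zero => simp
  | succ n ih => rw [pow_succ', Module.End.mul_apply, ih, hφ]; rfl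

theorem IsKEDerivation.one_sub_apply_mul {K A : Type*} [Field K] [Ring A] [Algebra K A]
    {δ : A →ₗ[K] A} (hδ : IsKEDerivation δ) (a b : A) :
    (1 - δ) (a * b) = (1 - δ) a * (1 - δ) b := by
  simp only [LinearMap.sub_apply, Module.End.one_apply, hδ a b]
  noncomm_ring

/-- The images of `1` under the powers of the endomorphism `1 - δ` stabilize. -/
theorem IsKEDerivation.exists_apply_pow_one_eq_zero {K A : Type*} [Field K] [Ring A]
    [Algebra K A] {δ : A →ₗ[K] A} (hδ : IsKEDerivation δ) (hLF : IsLocallyFiniteEnd δ) :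
    ∃ n : ℕ, δ (((1 - δ) ^ n) 1) = 0 := by
  have := hLF 1
  obtain ⟨n, b, c, hb, h1⟩ := exists_eq_add_pow_apply_of_map_mem (1 - δ)
    (Submodule.span K (Set.range fun i : ℕ => (δ ^ i) (1 : A)))
    (fun x hx => sub_mem hx (map_mem_span_range_pow δ 1 hx)) (self_mem_span_range_pow δ 1)
  have hmul := pow_apply_mul_of_apply_mul hδ.one_sub_apply_mul
  set φ : A →ₗ[K] A := 1 - δ with hφ
  -- Being in the image of the multiplicative map `φ ^ (n + 2)`, `(φ ^ (n + 1)) 1` is fixed by left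
  -- multiplication by `(φ ^ (n + 2)) 1`. The same product, computed through `φ ^ (n + 1)`, is `(φ ^
  -- (n + 2)) 1`.
  have hf : (φ ^ (n + 1)) 1 = (φ ^ (n + 2)) ((φ ^ n) c) := by
    conv_lhs => rw [h1]
    rw [map_add, hb, zero_add, ← Module.End.mul_apply, ← Module.End.mul_apply, ← pow_add,
      ← pow_add]
    congr 2
    omega
  have h2 : (φ ^ (n + 2)) 1 * (φ ^ (n + 1)) 1 = (φ ^ (n + 1)) 1 := by
    rw [hf, ← hmul, one_mul]
  have h3 : (φ ^ (n + 2)) 1 * (φ ^ (n + 1)) 1 = (φ ^ (n + 2)) 1 := by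
    rw [pow_succ φ (n + 1), Module.End.mul_apply, ← hmul, mul_one]
  have h4 : φ ((φ ^ (n + 1)) 1) = (φ ^ (n + 1)) 1 := by
    rw [← Module.End.mul_apply, ← pow_succ', ← h3, h2]
  refine ⟨n + 1, ?_⟩
  have h5 : δ = 1 - φ := by rw [hφ, sub_sub_cancel]
  rw [h5, LinearMap.sub_apply, h4, Module.End.one_apply, sub_self]

/-- Left multiplication by `g = ((1 - δ) ^ m) 1` commutes with `δ`, so `δ ^ n` kills `g * a - a`. So
does `(1 - δ) ^ m`, being multiplicative with the same value `g` at `g` and at `1`. -/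
theorem IsKEDerivation.pow_one_mul_eq_self {K A : Type*} [Field K] [Ring A] [Algebra K A]
    {δ : A →ₗ[K] A} (hδ : IsKEDerivation δ) {m : ℕ} (hm : δ (((1 - δ) ^ m) 1) = 0)
    (n : ℕ) (a : A) (ha : (δ ^ n) a = 0) : ((1 - δ) ^ m) 1 * a = a := by
  have hmul := pow_apply_mul_of_apply_mul hδ.one_sub_apply_mul
  set g : A := ((1 - δ) ^ m) 1 with hg
  have hδg : ∀ (i : ℕ) (x : A), (δ ^ i) (g * x) = g * (δ ^ i) x := by
    intro i x
    induction i with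
    | zero => simp
    | succ i ih =>
      rw [pow_succ', Module.End.mul_apply, ih, hδ, hm, Module.End.mul_apply]
      simp
  have hφg : ∀ i : ℕ, ((1 - δ) ^ i) g = g := by
    intro i
    induction i with
    | zero => simp
    | succ i ih =>
      rw [pow_succ', Module.End.mul_apply, ih, LinearMap.sub_apply, hm, sub_zero,
        Module.End.one_apply]
  refine sub_eq_zero.1 (eq_zero_of_pow_apply_eq_zero (η := δ) m n _ ?_ ?_)
  · rw [map_sub, hδg, ha, mul_zero, sub_zero]
  · rw [map_sub, hmul, hφg, hg, ← hmul, one_mul, sub_self]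

theorem IsKDerivation.apply_one {K A : Type*} [Field K] [Ring A] [Algebra K A]
    {D : A →ₗ[K] A} (hD : IsKDerivation D) : D 1 = 0 := by
  simpa using hD 1 1

theorem proposition1p4 {K : Type*} {A : Type*} [Field K] [CharZero K] [Ring A] [Algebra K A]
    (δ : A →ₗ[K] A) (hLF : IsLocallyFiniteEnd δ)
    (hδ : IsKDerivation δ ∨ IsKEDerivation δ) :
    (1 : A) ∈ LinearMap.range δ ↔ Function.Surjective δ := by
  refine ⟨?_, fun h => h 1⟩
  rintro ⟨u, hu⟩
  rcases hδ with hδ | hδ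
  · exact hLF.surjective_of_twisted_leibniz (ε := 0) (g := 1)
      (fun a b => by rw [hδ a b, zero_smul, sub_zero]) hu hδ.apply_one
      (fun _ a _ => one_mul a)
  · obtain ⟨m, hm⟩ := hδ.exists_apply_pow_one_eq_zero hLF
    exact hLF.surjective_of_twisted_leibniz (ε := 1)
      (fun a b => by rw [hδ a b, one_smul]) hu hm (hδ.pow_one_mul_eq_self hm)
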